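/- All graphs are finite and simple. For a graph $G$ let $\mathcal I(G)$ be the family of its independent sets. A fractional colouring of $G$ is a map $f:\mathcal I(G)\to[0,1]$ with $\sum_{I\in\mathcal I(G),\,v\in I}f(I)\ge 1$ for every vertex $v$; its weight is $\sum_{I\in\mathcal I(G)}f(I)$, and the fractional chromatic number $\chi_f(G)$ is the minimum weight of a fractional colouring of $G$. For a positive integer $n$, the $n$th cone $\Delta_n(G)$ over $G$ is the graph with vertex set $(V(G)\times\{0,1,\dots,n-1\})\cup\{\star\}$ and edge set $$\{(x,i)(y,j): xy\in E(G),\ |i-j|=1\text{ or }i=j=0\}\cup\{(x,n-1)\star: x\in V(G)\}.$$ For a graph $H$ and a map $h$ assigning a positive integer $h(v)$ to each vertex $v$ of $H$, the $(H,h)$-cone $\Delta_{H,h}(G)$ over $G$ is obtained from the disjoint union of copies $\Delta_{h(v)}(G)\times\{v\}$ of $\Delta_{h(v)}(G)$, one for each $v\in V(H)$, by identifying, for each $x\in V(G)$, all the vertices $((x,0),v)$, $v\in V(H)$, into a single vertex $(x,0)$, and adding the edges $(\star,v)(\star,v')$ for $vv'\in E(H)$. If $h$ is constantly equal to $n$,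 it is denoted by $\Delta_{H,n}(G)$. Let $$\tau(G,n)=\frac{1}{\sum_{k=0}^{n-1}(\chi_f(G)-1)^k}.$$ Let $G$ and $H$ be graphs, $H$ having at least one vertex, with $\chi_f(H)\le\chi_f(G)$, and let $h$ be a map from $V(H)$ to the positive integers. Let $n=\min\{h(v):v\in V(H)\}$, let $X=\{v\in V(H):h(v)=n\}$, and let $H[X]$ be the subgraph of $H$ induced by $X$. Then $$\chi_f(\Delta_{H[X],n}(G))\le\chi_f(\Delta_{H,h}(G))\le\chi_f(\Delta_{H,n}(G)).$$ In particular, if $n$ is even, then $\chi_f(\Delta_{H,h}(G))=\chi_f(G)+\tau(G,n)$. -/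

import Mathlib

/-- The family `𝓘(G)` of independent sets of a finite graph `G`. -/
abbrev IndepFamily {V : Type*} (G : SimpleGraph V) : Type _ :=
  {I : Finset V // G.IsIndepSet (I : Set V)}

/-- There are finitely many independent sets in a finite graph. -/
noncomputable instance indepFamilyFintype {V : Type*} [Fintype V] (G : SimpleGraph V) :
    Fintype (IndepFamily G) :=
  Fintype.ofFinite _

open Classical in
/-- A fractional colouring of `G`: a map `f : 𝓘(G) → [0,1]` such that for every vertex `v` the
values of `f` on the independent sets containing `v` sum to at least `1`. -/
def IsFractionalColouring {V : Type*} [Fintype V] (G : SimpleGraph V)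
    (f : IndepFamily G → ℝ) : Prop :=
  (∀ I, f I ∈ Set.Icc (0 : ℝ) 1) ∧
    ∀ v : V, 1 ≤ ∑ I : IndepFamily G with v ∈ I.1, f I

/-- The fractional chromatic number `χ_f(G)`: the minimum weight `∑ I, f I` of a fractional
colouring `f` of `G` (the minimum is attained, see `isLeast_fractionalChromaticNumber`). -/
noncomputable def fractionalChromaticNumber {V : Type*} [Fintype V] (G : SimpleGraph V) : ℝ :=
  sInf {w : ℝ | ∃ f : IndepFamily G → ℝ, IsFractionalColouring G f ∧ w = ∑ I, f I}

/-- The infimum in the definition of `χ_f` is a minimum. -/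
theorem isLeast_fractionalChromaticNumber {V : Type*} [Fintype V] (G : SimpleGraph V) :
    IsLeast {w : ℝ | ∃ f : IndepFamily G → ℝ, IsFractionalColouring G f ∧ w = ∑ I, f I}
      (fractionalChromaticNumber G) := by
  classical
  have hset : {w : ℝ | ∃ f : IndepFamily G → ℝ, IsFractionalColouring G f ∧ w = ∑ I, f I} =
      (fun f : IndepFamily G → ℝ => ∑ I, f I) '' {f | IsFractionalColouring G f} := by
    ext w
    constructor
    · rintro ⟨f, hf, rfl⟩
      exact ⟨f, hf, rfl⟩
    · rintro ⟨f, hf, rfl⟩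
      exact ⟨f, hf, rfl⟩
  have hcomp : IsCompact {f : IndepFamily G → ℝ | IsFractionalColouring G f} := by
    have hbox : IsCompact (Set.univ.pi fun _ : IndepFamily G => Set.Icc (0 : ℝ) 1) :=
      isCompact_univ_pi fun _ => isCompact_Icc
    have hcl : IsClosed {f : IndepFamily G → ℝ |
        ∀ v : V, 1 ≤ ∑ I : IndepFamily G with v ∈ I.1, f I} := by
      simp only [Set.ofPred_forall]
      exact isClosed_iInter fun v => isClosed_le (by fun_prop) (by fun_prop)
    convert hbox.inter_right hcl using 1
    ext f
    simp only [IsFractionalColouring, Set.mem_ofPred_eq, Set.mem_inter_iff, Set.mem_pi,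
      Set.mem_univ, true_implies]
  have hne : {f : IndepFamily G → ℝ | IsFractionalColouring G f}.Nonempty := by
    refine ⟨fun _ => 1, fun _ => by simp, fun v => ?_⟩
    have hv : G.IsIndepSet (({v} : Finset V) : Set V) := by simp [SimpleGraph.IsIndepSet]
    refine le_trans (le_of_eq ?_) (Finset.single_le_sum (f := fun _ : IndepFamily G => (1 : ℝ))
      (fun _ _ => zero_le_one) (Finset.mem_filter.2
        ⟨Finset.mem_univ (⟨{v}, hv⟩ : IndepFamily G), by simp⟩))
    rfl
  rw [fractionalChromaticNumber, hset]
  exact (hcomp.image (by fun_prop)).isLeast_sInf (hne.image _)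

/-- Vertices of the `(H,h)`-cone over `G`, where `V = V(G)` and `W = V(H)`: after identifying the
bases of the cones `Δ_{h(v)}(G, v)`, these are the common base vertices `(x, 0)`, the vertices
`((x, i), v)` with `0 < i < h v`, and the apex vertices `(⋆, v)`. -/
inductive HConeVertex (V : Type*) {W : Type*} (h : W → ℕ) : Type _
  | base (x : V) : HConeVertex V h
  | layer (v : W) (i : Set.Ioo 0 (h v)) (x : V) : HConeVertex V h
  | apex (v : W) : HConeVertex V h

/-- The vertex set as a disjoint union. -/
def HConeVertex.equivSum (V : Type*) {W : Type*} (h : W → ℕ) :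
    HConeVertex V h ≃ V ⊕ (Σ v : W, Set.Ioo 0 (h v) × V) ⊕ W where
  toFun
    | .base x => .inl x
    | .layer v i x => .inr (.inl ⟨v, i, x⟩)
    | .apex v => .inr (.inr v)
  invFun
    | .inl x => .base x
    | .inr (.inl ⟨v, i, x⟩) => .layer v i x
    | .inr (.inr v) => .apex v
  left_inv := by rintro (_ | _ | _) <;> rfl
  right_inv := by rintro (_ | ⟨_, _, _⟩ | _) <;> rfl

instance HConeVertex.instFintype {V W : Type*} [Fintype V] [Fintype W] (h : W → ℕ) :
    Fintype (HConeVertex V h) :=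
  Fintype.ofEquiv _ (HConeVertex.equivSum V h).symm

/-- Adjacency in the `(H,h)`-cone over `G`. Within each cone `Δ_{h(v)}(G, v)`, `(x, i)` and `(y, j)`
are adjacent iff `xy ∈ E(G)` and (`|i - j| = 1` or `i = j = 0`), and `(x, i)` is adjacent to the
apex iff `i = h(v) - 1`; moreover `(⋆, v)` and `(⋆, w)` are adjacent iff `vw ∈ E(H)`. -/
def HConeVertex.Adj {V W : Type*} (G : SimpleGraph V) (H : SimpleGraph W) (h : W → ℕ) :
    HConeVertex V h → HConeVertex V h → Prop
  | .base x, .base y => G.Adj x y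
  | .base x, .layer _ i y => G.Adj x y ∧ (i : ℕ) = 1
  | .layer _ i x, .base y => G.Adj x y ∧ (i : ℕ) = 1
  | .layer v i x, .layer w j y =>
      v = w ∧ G.Adj x y ∧ ((i : ℕ) + 1 = (j : ℕ) ∨ (j : ℕ) + 1 = (i : ℕ))
  | .base _, .apex v => h v = 1
  | .apex v, .base _ => h v = 1
  | .layer v i _, .apex w => v = w ∧ (i : ℕ) + 1 = h v
  | .apex w, .layer v i _ => v = w ∧ (i : ℕ) + 1 = h v
  | .apex v, .apex w => H.Adj v w

/-- The `(H,h)`-cone `Δ_{H,h}(G)` over `G`, for `h : V(H) → ℕ` with positive values. -/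
def hCone {V W : Type*} (G : SimpleGraph V) (H : SimpleGraph W) (h : W → ℕ) :
    SimpleGraph (HConeVertex V h) where
  Adj := HConeVertex.Adj G H h
  symm := ⟨by
    rintro (x | ⟨v, i, x⟩ | v) (y | ⟨w, j, y⟩ | w) hab <;> simp only [HConeVertex.Adj] at hab ⊢
    · exact hab.symm
    · exact ⟨hab.1.symm, hab.2⟩
    · exact hab
    · exact ⟨hab.1.symm, hab.2⟩
    · exact ⟨hab.1.symm, hab.2.1.symm, hab.2.2.symm⟩
    · exact hab
    · exact hab
    · exact hab
    · exact hab.symm⟩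
  loopless := ⟨by
    rintro (x | ⟨v, i, x⟩ | v) hab <;> simp [HConeVertex.Adj] at hab⟩

/-- `Δ_{H,n}(G)`: the `(H,h)`-cone over `G` with `h` constantly equal to `n`. -/
abbrev constHCone {V W : Type*} (G : SimpleGraph V) (H : SimpleGraph W) (n : ℕ) :
    SimpleGraph (HConeVertex V (fun _ : W => n)) :=
  hCone G H (fun _ => n)

/-- `τ(G,n) = 1 / ∑_{k=0}^{n-1} (χ_f(G) - 1)^k`. -/
noncomputable def coneTau {V : Type*} [Fintype V] (G : SimpleGraph V) (n : ℕ) : ℝ :=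
  1 / ∑ k ∈ Finset.range n, (fractionalChromaticNumber G - 1) ^ k

/-! Both inequalities for general `n` come from homomorphisms: the cones of height `n` form a
subgraph of `Δ_{H,h}(G)`, and folding the lowest layers of the taller cones onto the base maps
`Δ_{H,h}(G)` to `Δ_{H,n}(G)` (`constHCone_induce_le_hCone`, `hCone_le_constHCone`).

For the equality put `c = χ_f(G)`, `m = c - 1`, `τ = τ(G,n)`.

Lower bound (`add_coneTau_le_hCone`, any parity): by LP duality `G` has a fractional clique `w` of
weight `c`. In one cone of height `n`, give `(x, i)` the weight `τ * m ^ (n - 1 - i) * w x` and the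
apex the weight `τ`. The total is `c + τ`, and no independent set carries more than `1`. The latter
is an inequality for sequences of layers (`layered_setWeight_le`), a weighted combination of local
bounds on consecutive layers (`setWeight_add_le`).

Upper bound (`constHCone_le_add_coneTau`, `n = 2 * l`): choose independently `I` from an optimal
colouring of `G`, `J` from a colouring of `H` of weight `c` covering each vertex exactly once, and a
random threshold `t`. The set `coneIndepSet n I J t` copies `I` far from the apices and alternates
full and empty layers near them. These sets get total weight `c`; one further set of weight `τ` tops
up the layers at odd distance from the apex. The law of `t` is fixed by a recurrence that makes the
coverage bound at those layers equal to `1`. -/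

/-! ### Linear programming bounds and duality for `χ_f`. -/

open Classical in
/-- Any weighted family of independent sets covering each vertex with total weight at least `1`
bounds the fractional chromatic number from above. -/
theorem fractionalChromaticNumber_le_of_cover {V ι : Type*} [Fintype V] [Fintype ι]
    (G : SimpleGraph V) (p : ι → ℝ) (hp : ∀ i, 0 ≤ p i) (K : ι → Set V)
    (hK : ∀ i, G.IsIndepSet (K i))
    (hcov : ∀ x, 1 ≤ ∑ i, p i * (K i).indicator 1 x) :
    fractionalChromaticNumber G ≤ ∑ i, p i := by
  let k : ι → IndepFamily G := fun i => ⟨(K i).toFinset, by simpa using hK i⟩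
  let q : IndepFamily G → ℝ := fun I => ∑ i with k i = I, p i
  have hq : ∀ I, 0 ≤ q I := fun I => Finset.sum_nonneg fun i _ => hp i
  -- Capping at `1` is harmless: a vertex in a set of pooled weight at least `1` is covered by that
  -- set alone, and at any other vertex no relevant value is capped.
  have hcol : IsFractionalColouring G fun I => min 1 (q I) := by
    refine ⟨fun I => ⟨le_min zero_le_one (hq I), min_le_left _ _⟩, fun v => ?_⟩
    by_cases hbig : ∃ I : IndepFamily G, v ∈ I.1 ∧ 1 ≤ q I
    · obtain ⟨I, hvI, hI⟩ := hbig
      calc (1 : ℝ) = min 1 (q I) := (min_eq_left hI).symm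
        _ ≤ _ := Finset.single_le_sum (f := fun I => min 1 (q I))
          (fun I _ => le_min zero_le_one (hq I)) (by simpa using hvI)
    · push Not at hbig
      calc (1 : ℝ) ≤ ∑ i, p i * (K i).indicator 1 v := hcov v
        _ = ∑ i with v ∈ (k i).1, p i := by
          rw [Finset.sum_filter]
          refine Finset.sum_congr rfl fun i _ => ?_
          by_cases hv : v ∈ K i <;> simp [k, hv]
        _ = ∑ I : IndepFamily G with v ∈ I.1, q I := by
          rw [← Finset.sum_fiberwise_of_maps_to (t := Finset.univ.filter
            fun I : IndepFamily G => v ∈ I.1) (g := k) (by simp)]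
          refine Finset.sum_congr rfl fun I hI => ?_
          rw [Finset.filter_filter]
          refine Finset.sum_congr (Finset.filter_congr fun i _ => ?_) fun _ _ => rfl
          constructor
          · exact fun h => h.2
          · rintro rfl
            exact ⟨by simpa using hI, rfl⟩
        _ = ∑ I : IndepFamily G with v ∈ I.1, min 1 (q I) := by
          refine Finset.sum_congr rfl fun I hI => ?_
          rw [min_eq_right (hbig I (by simpa using hI)).le]
  calc fractionalChromaticNumber G ≤ ∑ I, min 1 (q I) :=
        (isLeast_fractionalChromaticNumber G).2 ⟨_, hcol, rfl⟩
    _ ≤ ∑ I, q I := Finset.sum_le_sum fun I _ => min_le_right _ _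
    _ = ∑ i, p i := Finset.sum_fiberwise _ _ _

/-- An optimal fractional colouring, with coverage written through indicator functions. -/
theorem exists_optimal_cover {V : Type*} [Fintype V] (G : SimpleGraph V) :
    ∃ f : IndepFamily G → ℝ, (∀ I, 0 ≤ f I) ∧ ∑ I, f I = fractionalChromaticNumber G ∧
      ∀ x, 1 ≤ ∑ I, f I * (I.1 : Set V).indicator 1 x := by
  classical
  obtain ⟨f, hf, hsum⟩ := (isLeast_fractionalChromaticNumber G).1
  refine ⟨f, fun I => (hf.1 I).1, hsum.symm, fun x => (hf.2 x).trans_eq ?_⟩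
  rw [Finset.sum_filter]
  refine Finset.sum_congr rfl fun I _ => ?_
  by_cases hx : x ∈ I.1 <;> simp [hx]

/-- Weak duality: a weighted family of vertices of which every independent set carries weight at
most `1` bounds the fractional chromatic number from below. -/
theorem sum_le_fractionalChromaticNumber {V ι : Type*} [Fintype V] [Fintype ι]
    (G : SimpleGraph V) (b : ι → ℝ) (hb : ∀ i, 0 ≤ b i) (k : ι → V)
    (h : ∀ I : Set V, G.IsIndepSet I → ∑ i, b i * I.indicator 1 (k i) ≤ 1) :
    ∑ i, b i ≤ fractionalChromaticNumber G := by
  obtain ⟨f, hf0, hfs, hfc⟩ := exists_optimal_cover G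
  calc ∑ i, b i ≤ ∑ i, b i * ∑ I, f I * (I.1 : Set V).indicator 1 (k i) :=
        Finset.sum_le_sum fun i _ => le_mul_of_one_le_right (hb i) (hfc _)
    _ = ∑ I : IndepFamily G, f I * ∑ i, b i * (I.1 : Set V).indicator 1 (k i) := by
        simp only [Finset.mul_sum]
        rw [Finset.sum_comm]
        exact Finset.sum_congr rfl fun _ _ => Finset.sum_congr rfl fun _ _ => by ring
    _ ≤ ∑ I, f I := Finset.sum_le_sum fun I _ => mul_le_of_le_one_right (hf0 I) (h _ I.2)
    _ = _ := hfs

/-- A graph homomorphism does not decrease the fractional chromatic number. -/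
theorem fractionalChromaticNumber_le_of_hom {V W : Type*} [Fintype V] [Fintype W]
    {G : SimpleGraph V} {H : SimpleGraph W} (φ : G →g H) :
    fractionalChromaticNumber G ≤ fractionalChromaticNumber H := by
  obtain ⟨f, hf0, hfs, hfc⟩ := exists_optimal_cover H
  rw [← hfs]
  refine fractionalChromaticNumber_le_of_cover G f hf0 (fun I => φ ⁻¹' (I.1 : Set W))
    (fun I x hx y hy _ hxy => ?_) fun x => hfc (φ x)
  exact I.2 hx hy (φ.map_adj hxy).ne (φ.map_adj hxy)

theorem one_le_fractionalChromaticNumber {V : Type*} [Fintype V] (G : SimpleGraph V) (x : V) :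
    1 ≤ fractionalChromaticNumber G := by
  classical
  have := sum_le_fractionalChromaticNumber G (fun _ : Unit => 1) (by simp) (fun _ => x)
    (fun I _ => by by_cases hx : x ∈ I <;> simp [hx])
  simpa using this

theorem two_le_fractionalChromaticNumber {V : Type*} [Fintype V] {G : SimpleGraph V} {x y : V}
    (hxy : G.Adj x y) : 2 ≤ fractionalChromaticNumber G := by
  classical
  have := sum_le_fractionalChromaticNumber G (fun _ : Bool => 1) (by simp)
    (fun b => if b then x else y) (fun I hI => by
      by_cases hx : x ∈ I <;> by_cases hy : y ∈ I <;> simp [hx, hy]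
      exact (hI hx hy hxy.ne hxy).elim)
  simpa using this

theorem fractionalChromaticNumber_le_one {V : Type*} [Fintype V] {G : SimpleGraph V}
    (h : ∀ x y, ¬ G.Adj x y) : fractionalChromaticNumber G ≤ 1 := by
  have := fractionalChromaticNumber_le_of_cover G (fun _ : Unit => 1) (by simp)
    (fun _ => Set.univ) (fun _ x _ y _ _ => h x y) (by simp)
  simpa using this

/-- An optimal fractional clique: strong duality for the fractional chromatic number. -/
theorem exists_fractionalClique {V : Type*} [Fintype V] [Nonempty V] (G : SimpleGraph V) :
    ∃ w : V → ℝ, (∀ x, 0 ≤ w x) ∧ ∑ x, w x = fractionalChromaticNumber G ∧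
      ∀ I : Set V, G.IsIndepSet I → ∑ x, w x * I.indicator 1 x ≤ 1 := by
  classical
  set c := fractionalChromaticNumber G with hc
  have hc1 : 1 ≤ c := one_le_fractionalChromaticNumber G (Classical.arbitrary V)
  have hc0 : 0 < c := by linarith
  let e : IndepFamily G → V → ℝ := fun I => (I.1 : Set V).indicator 1
  let Q : Set (V → ℝ) := Set.univ.pi fun _ => Set.Ioi c⁻¹
  -- A common point, divided by its least coordinate, would be a cover of weight below `c`.
  have hdisj : Disjoint Q (convexHull ℝ (Set.range e)) := by
    rw [Set.disjoint_left]
    intro u huQ huP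
    rw [convexHull_range_eq_exists_affineCombination] at huP
    obtain ⟨s, p, hp0, hp1, rfl⟩ := huP
    rw [Finset.affineCombination_eq_linear_combination _ _ _ hp1] at huQ
    set u : V → ℝ := ∑ I ∈ s, p I • e I with hu
    obtain ⟨x₀, hx₀⟩ := Finite.exists_min u
    have hδ : c⁻¹ < u x₀ := huQ x₀ trivial
    have hδ0 : 0 < u x₀ := (inv_pos.2 hc0).trans hδ
    have hle := fractionalChromaticNumber_le_of_cover G (fun I : s => p I / u x₀)
      (fun I => div_nonneg (hp0 _ I.2) hδ0.le) (fun I => (I.1.1 : Set V)) (fun I => I.1.2)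
      (fun x => by
        have : ∑ I : s, p I / u x₀ * (I.1.1 : Set V).indicator 1 x = u x / u x₀ := by
          rw [show u x = ∑ I ∈ s, (p I • e I) x by rw [hu, Finset.sum_apply], Finset.sum_div,
            ← Finset.sum_coe_sort s]
          refine Finset.sum_congr rfl fun I _ => ?_
          simp only [e, Pi.smul_apply, smul_eq_mul]
          ring
        rw [this, le_div_iff₀ hδ0, one_mul]
        exact hx₀ x)
    rw [← Finset.sum_div, Finset.sum_coe_sort s p, hp1, ← hc] at hle
    rw [inv_lt_comm₀ hc0 hδ0, ← one_div] at hδ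
    linarith
  obtain ⟨φ, r, hφQ, hφP⟩ := geometric_hahn_banach_open
    (convex_pi fun _ _ => convex_Ioi _) (isOpen_set_pi Set.finite_univ fun _ _ => isOpen_Ioi)
    (convex_convexHull ℝ (Set.range e)) hdisj
  let w : V → ℝ := fun x => -φ (Pi.single x 1)
  have hφ : ∀ u : V → ℝ, φ u = -∑ x, w x * u x := fun u => by
    conv_lhs => rw [← Finset.univ_sum_single u]
    rw [map_sum, ← Finset.sum_neg_distrib]
    refine Finset.sum_congr rfl fun x _ => ?_
    rw [show (Pi.single x (u x) : V → ℝ) = u x • Pi.single x 1 by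
      rw [← Pi.single_smul, smul_eq_mul, mul_one], map_smul]
    simp [w]; ring
  have hP : ∀ I : Set V, G.IsIndepSet I → ∑ x, w x * I.indicator 1 x ≤ -r := fun I hI => by
    have := hφP _ (subset_convexHull ℝ _ ⟨⟨I.toFinset, by simpa using hI⟩, rfl⟩)
    rw [hφ] at this
    simp only [e, Set.coe_toFinset] at this
    linarith
  have hQ : ∀ u : V → ℝ, (∀ x, c⁻¹ < u x) → -r < ∑ x, w x * u x := fun u hu => by
    have := hφQ u fun x _ => hu x
    rw [hφ] at this
    linarith
  have hw0 : ∀ x, 0 ≤ w x := fun x => by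
    by_contra! hx
    let A := ∑ y, w y * (c⁻¹ + 1)
    -- Raising coordinate `x` by this amount stays in `Q` but lowers the functional to `A - |A + r|
    -- ≤ -r`.
    have ht : 0 ≤ (|A + r| / -w x) := div_nonneg (abs_nonneg _) (by linarith)
    have := hQ (fun y => c⁻¹ + 1 + (Pi.single x (|A + r| / -w x) : V → ℝ) y) fun y => by
      by_cases hy : y = x
      · subst hy; simp; linarith
      · simp [hy]
    simp only [mul_add (w _) (c⁻¹ + 1), Finset.sum_add_distrib] at this
    rw [Fintype.sum_eq_single (f := fun y => w y * (Pi.single x (|A + r| / -w x) : V → ℝ) y) x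
      (by simp +contextual), Pi.single_eq_same, show w x * (|A + r| / -w x) = -|A + r| by rw [div_neg, mul_neg, mul_div_cancel₀ _ hx.ne]] at this
    have := le_abs_self (A + r)
    simp only [A] at *
    linarith
  have hr0 : 0 ≤ -r := by simpa using hP ∅ (by simp [SimpleGraph.IsIndepSet])
  have hr : 0 < -r := by
    refine hr0.lt_of_ne fun h0 => ?_
    have hw : ∀ x, w x = 0 := fun x => le_antisymm (by
      have := hP {x} (by simp [SimpleGraph.IsIndepSet])
      rw [Finset.sum_eq_single x (by simp +contextual) (by simp)] at this
      simpa [← h0] using this) (hw0 x)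
    have := hQ (fun _ => c⁻¹ + 1) (by simp)
    simp [hw, ← h0] at this
  have hsum : c * -r ≤ ∑ x, w x := by
    by_contra! hlt
    have hpos : 0 ≤ ∑ x, w x := Finset.sum_nonneg fun x _ => hw0 x
    obtain ⟨t, ht, ht'⟩ : ∃ t, c⁻¹ < t ∧ (∑ x, w x) * t ≤ -r := by
      rcases hpos.eq_or_lt with h0 | h0
      · exact ⟨c⁻¹ + 1, by simp, by rw [← h0]; simpa using hr0⟩
      · refine ⟨-r / ∑ x, w x, ?_, (mul_div_cancel₀ _ h0.ne').le⟩
        rw [lt_div_iff₀ h0, inv_mul_lt_iff₀ hc0]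
        exact hlt
    have := hQ (fun _ => t) fun _ => ht
    rw [← Finset.sum_mul] at this
    linarith
  have hclique : ∀ I : Set V, G.IsIndepSet I → ∑ x, w x / -r * I.indicator 1 x ≤ 1 :=
    fun I hI => by
      have : ∑ x, w x / -r * I.indicator 1 x = (∑ x, w x * I.indicator 1 x) / -r := by
        rw [Finset.sum_div]
        exact Finset.sum_congr rfl fun _ _ => by ring
      rw [this, div_le_one hr]
      exact hP I hI
  have hnn : ∀ x, 0 ≤ w x / -r := fun x => div_nonneg (hw0 x) hr0
  refine ⟨fun x => w x / -r, hnn, le_antisymm ?_ ?_, hclique⟩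
  · exact sum_le_fractionalChromaticNumber G _ hnn id hclique
  · rw [← Finset.sum_div, le_div_iff₀ hr]
    exact hsum

/-- An optimal fractional colouring can be thinned, and padded with empty sets, so that every
vertex is covered with total weight exactly `1`. -/
theorem exists_exact_cover.{u} {W : Type u} [Fintype W] (H : SimpleGraph W) {c : ℝ}
    (hc : fractionalChromaticNumber H ≤ c) :
    ∃ (κ : Type u) (_ : Fintype κ) (g : κ → ℝ) (J : κ → Set W), (∀ k, 0 ≤ g k) ∧
      (∀ k, H.IsIndepSet (J k)) ∧ ∑ k, g k = c ∧ ∀ v, ∑ k, g k * (J k).indicator 1 v = 1 := by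
  classical
  suffices h : ∀ A : Finset W, ∃ (κ : Type u) (_ : Fintype κ) (g : κ → ℝ) (J : κ → Set W),
      (∀ k, 0 ≤ g k) ∧ (∀ k, H.IsIndepSet (J k)) ∧ ∑ k, g k = c ∧
      (∀ v, 1 ≤ ∑ k, g k * (J k).indicator 1 v) ∧
      ∀ v ∈ A, ∑ k, g k * (J k).indicator 1 v = 1 by
    obtain ⟨κ, hκ, g, J, h1, h2, h3, -, h5⟩ := h Finset.univ
    exact ⟨κ, hκ, g, J, h1, h2, h3, fun v => h5 v (Finset.mem_univ v)⟩
  intro A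
  induction A using Finset.induction_on with
  | empty =>
    obtain ⟨f, hf0, hfs, hfc⟩ := exists_optimal_cover H
    refine ⟨Option (IndepFamily H), inferInstance,
      fun o => o.elim (c - fractionalChromaticNumber H) f, fun o => o.elim ∅ fun I => (I.1 : Set W),
      ?_, ?_, ?_, ?_, by simp⟩
    · rintro (_ | I)
      · exact sub_nonneg.2 hc
      · exact hf0 I
    · rintro (_ | I)
      · simp [SimpleGraph.IsIndepSet]
      · exact I.2
    · simp [Fintype.sum_option, hfs]
    · intro v
      simpa [Fintype.sum_option] using hfc v
  | insert v A _ ih =>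
    obtain ⟨κ, hκ, g, J, h1, h2, h3, h4, h5⟩ := ih
    set s := ∑ k, g k * (J k).indicator 1 v with hs
    have hs1 : 1 ≤ s := h4 v
    have hs0 : 0 < s := by linarith
    -- Each set is split into a copy keeping `v`, with share `s⁻¹`, and a copy without `v`: coverage
    -- at `v` drops from `s` to `1` and is unchanged elsewhere.
    have hother : ∀ u, u ≠ v → ∑ k : κ × Bool, (g k.1 * if k.2 then s⁻¹ else 1 - s⁻¹) *
        (if k.2 then J k.1 else J k.1 \ {v}).indicator 1 u =
          ∑ k, g k * (J k).indicator 1 u := by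
      intro u hu
      rw [Fintype.sum_prod_type]
      refine Finset.sum_congr rfl fun k _ => ?_
      by_cases hk : u ∈ J k
      · simp [hk, hu]; ring
      · simp [hk]
    have hself : ∑ k : κ × Bool, (g k.1 * if k.2 then s⁻¹ else 1 - s⁻¹) *
        (if k.2 then J k.1 else J k.1 \ {v}).indicator 1 v = 1 := by
      rw [Fintype.sum_prod_type, ← mul_inv_cancel₀ hs0.ne', hs, Finset.sum_mul, ← hs]
      refine Finset.sum_congr rfl fun k _ => ?_
      simp
      ring
    refine ⟨κ × Bool, inferInstance, fun k => g k.1 * if k.2 then s⁻¹ else 1 - s⁻¹,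
      fun k => if k.2 then J k.1 else J k.1 \ {v}, ?_, ?_, ?_, ?_, ?_⟩
    · rintro ⟨k, b⟩
      refine mul_nonneg (h1 k) ?_
      cases b
      · simpa using inv_le_one_of_one_le₀ hs1
      · simpa using hs0.le
    · rintro ⟨k, b⟩
      cases b
      · exact (h2 k).mono Set.sdiff_subset
      · exact h2 k
    · rw [Fintype.sum_prod_type, ← h3]
      refine Finset.sum_congr rfl fun k _ => ?_
      simp; ring
    · intro u
      by_cases hu : u = v
      · subst hu; exact hself.ge
      · rw [hother u hu]; exact h4 u
    · intro u hu
      by_cases huv : u = v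
      · subst huv; exact hself
      · rw [hother u huv]
        exact h5 u ((Finset.mem_insert.1 hu).resolve_left huv)

/-! ### An inequality for sequences with alternating multipliers. -/

/-- The coefficients `0, 1, m - 1, m ^ 2 - m + 1, …`. -/
def altGeom (m : ℝ) : ℕ → ℝ
  | 0 => 0
  | k + 1 => m * altGeom m k + (-1) ^ k

theorem altGeom_succ_add (m : ℝ) (k : ℕ) : altGeom m (k + 1) + altGeom m k = m ^ k := by
  induction k with
  | zero => simp [altGeom]
  | succ k ih =>
    have h1 : altGeom m (k + 2) = m * altGeom m (k + 1) + (-1) ^ (k + 1) := rfl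
    have h2 : altGeom m (k + 1) = m * altGeom m k + (-1) ^ k := rfl
    rw [pow_succ m, ← ih]
    rw [pow_succ] at h1
    linear_combination h1 + h2

/-- The stronger bound at odd indices absorbs the `-1` in the step to the next even index. -/
theorem altGeom_bounds {m : ℝ} (hm : 1 ≤ m) (k : ℕ) :
    0 ≤ altGeom m k ∧ (Odd k → 1 ≤ altGeom m k) := by
  induction k with
  | zero => simp [altGeom]
  | succ k ih =>
    rcases Nat.even_or_odd k with hk | hk
    · have : altGeom m (k + 1) = m * altGeom m k + 1 := by simp [altGeom, hk.neg_one_pow]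
      have : 0 ≤ m * altGeom m k := mul_nonneg (by linarith) ih.1
      exact ⟨by linarith, fun _ => by linarith⟩
    · have : altGeom m (k + 1) = m * altGeom m k - 1 := by
        simp [altGeom, hk.neg_one_pow]; ring
      have : 1 ≤ m * altGeom m k := one_le_mul_of_one_le_of_one_le hm (ih.2 hk)
      exact ⟨by linarith, fun h => absurd h (Nat.not_odd_iff_even.2 hk.add_one)⟩

/-- Sum `m ^ i = altGeom m (i + 1) + altGeom m i` and expand the first term by the recursion; the
signs add up to `(1 + (-1) ^ k) / 2`. -/
theorem geom_sum_eq_altGeom (m : ℝ) (k : ℕ) :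
    ∑ i ∈ Finset.range (k + 1), m ^ i =
      (1 + m) * ∑ j ∈ Finset.range (k + 1), altGeom m j + (1 + (-1) ^ k) / 2 := by
  induction k with
  | zero => simp [altGeom]
  | succ k ih =>
    rw [Finset.sum_range_succ, ih, Finset.sum_range_succ _ (k + 1), ← altGeom_succ_add m (k + 1)]
    have h1 : altGeom m (k + 2) = m * altGeom m (k + 1) + (-1) ^ (k + 1) := rfl
    rw [pow_succ] at h1 ⊢
    linear_combination h1

/-- Add the inequalities `h3 i` with multipliers `altGeom m (k - i)`: for `i ≥ 1` consecutive
multipliers add up to the coefficient `m ^ (k - i)` of `a i`. The `δ` terms are paid for by the `μ`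
terms. The bound keeps the unused share of `μ 0`, so that the induction, which shifts the sequences,
can spend it. -/
theorem weighted_sum_le_altGeom {m : ℝ} (hm : 1 ≤ m) (k : ℕ) (a δ μ : ℕ → ℝ)
    (h1 : ∀ i, δ i ≤ μ i) (h2 : ∀ i, δ i ≤ μ (i + 1))
    (h3 : ∀ i, a i + a (i + 1) - δ i + m * μ i ≤ 1 + m) :
    ∑ i ∈ Finset.range (k + 1), m ^ (k - i) * a i ≤
      (1 + m) * ∑ j ∈ Finset.range (k + 1), altGeom m j + altGeom m (k + 1) * a 0 -
        (m * altGeom m k - (1 - (-1) ^ k) / 2) * μ 0 := by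
  induction k generalizing a δ μ with
  | zero => simp [altGeom]
  | succ k ih =>
    have hih := ih (fun i => a (i + 1)) (fun i => δ (i + 1)) (fun i => μ (i + 1))
      (fun i => h1 _) (fun i => h2 _) (fun i => h3 _)
    simp only [zero_add] at hih
    rw [Finset.sum_range_succ', Finset.sum_range_succ _ (k + 1)]
    simp only [Nat.add_sub_add_right, Nat.sub_zero]
    obtain ⟨hy0, hyodd⟩ := altGeom_bounds hm (k + 1)
    have h3' := mul_le_mul_of_nonneg_left (h3 0) hy0
    simp only [zero_add] at h3'
    have hrec : altGeom m (k + 1) = m * altGeom m k + (-1) ^ k := rfl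
    have hpow := altGeom_succ_add m (k + 1)
    -- The multipliers of `δ 0` and `μ 1` differ by one unit. For even `k` the missing unit is
    -- charged to `μ 0`; for odd `k` the spare unit at `μ 1` has already been spent.
    have key : altGeom m (k + 1) * δ 0 - (m * altGeom m k - (1 - (-1) ^ k) / 2) * μ 1 ≤
        (1 - (-1) ^ (k + 1)) / 2 * μ 0 := by
      have hδ0 := h1 0
      have hδ1 := h2 0
      rw [zero_add] at hδ1
      rcases Nat.even_or_odd k with hk | hk
      · rw [pow_succ, hk.neg_one_pow] at *
        have := mul_le_mul_of_nonneg_left hδ1 (sub_nonneg.2 (hyodd hk.add_one))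
        have e : m * altGeom m k = altGeom m (k + 1) - 1 := by linarith
        rw [e]
        linarith
      · rw [pow_succ, hk.neg_one_pow] at *
        have := mul_le_mul_of_nonneg_left hδ1 hy0
        have e : m * altGeom m k = altGeom m (k + 1) + 1 := by linarith
        rw [e]
        linarith
    have e : m ^ (k + 1) * a 0 = altGeom m (k + 1 + 1) * a 0 + altGeom m (k + 1) * a 0 := by
      rw [← hpow]; ring
    rw [e]
    linarith

/-- With `μ 0 = a 0` the boundary terms collapse to `(1 + (-1) ^ k) / 2 * a 0`, matching the
correction in `geom_sum_eq_altGeom`. -/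
theorem weighted_sum_le_geom_sum {m : ℝ} (hm : 1 ≤ m) (n : ℕ) (a δ μ : ℕ → ℝ)
    (h0 : μ 0 = a 0) (h0' : a 0 ≤ 1)
    (h1 : ∀ i, δ i ≤ μ i) (h2 : ∀ i, δ i ≤ μ (i + 1))
    (h3 : ∀ i, a i + a (i + 1) - δ i + m * μ i ≤ 1 + m) :
    ∑ i ∈ Finset.range n, m ^ (n - 1 - i) * a i ≤ ∑ i ∈ Finset.range n, m ^ i := by
  obtain _ | k := n
  · simp
  have h := weighted_sum_le_altGeom hm k a δ μ h1 h2 h3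
  rw [h0] at h
  simp only [Nat.add_sub_cancel]
  rw [geom_sum_eq_altGeom]
  have hrec : altGeom m (k + 1) = m * altGeom m k + (-1) ^ k := rfl
  rw [hrec] at h
  rcases Nat.even_or_odd k with hk | hk
  · rw [hk.neg_one_pow] at *
    linarith
  · rw [hk.neg_one_pow] at *
    linarith

/-! ### Fractional clique weights of consecutive layers. -/

/-- The weight of a set of vertices. -/
noncomputable def setWeight {V : Type*} [Fintype V] (w : V → ℝ) (A : Set V) : ℝ :=
  ∑ x, w x * A.indicator 1 x

theorem setWeight_mono {V : Type*} [Fintype V] {w : V → ℝ} (hw : ∀ x, 0 ≤ w x) {A B : Set V}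
    (h : A ⊆ B) : setWeight w A ≤ setWeight w B :=
  Finset.sum_le_sum fun x _ => mul_le_mul_of_nonneg_left
    (Set.indicator_le_indicator_of_subset h (fun _ => zero_le_one) x) (hw x)

@[simp]
theorem setWeight_empty {V : Type*} [Fintype V] (w : V → ℝ) : setWeight w ∅ = 0 := by
  simp [setWeight]

theorem setWeight_union {V : Type*} [Fintype V] (w : V → ℝ) (A B : Set V) :
    setWeight w (A ∪ B) = setWeight w A + setWeight w B - setWeight w (A ∩ B) := by
  simp only [setWeight]
  rw [eq_sub_iff_add_eq, ← Finset.sum_add_distrib, ← Finset.sum_add_distrib]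
  refine Finset.sum_congr rfl fun x _ => ?_
  rw [← mul_add, ← mul_add]
  congr 1
  exact congrFun (Set.indicator_union_add_inter (1 : V → ℝ) A B) x

/-- If the vertices of `C ⊆ U` are isolated in `U`, then a fractional clique puts little weight
on `U`. -/
theorem setWeight_add_le {V : Type*} [Fintype V] (G : SimpleGraph V) {w : V → ℝ}
    (hw : ∀ x, 0 ≤ w x) (hI : ∀ I : Set V, G.IsIndepSet I → setWeight w I ≤ 1)
    {C U : Set V} (hCU : C ⊆ U) (hC : ∀ x ∈ C, ∀ y ∈ U, ¬ G.Adj x y) :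
    setWeight w U + (fractionalChromaticNumber G - 1) * setWeight w C ≤
      fractionalChromaticNumber G := by
  classical
  obtain ⟨f, hf0, hfs, hfc⟩ := exists_optimal_cover G
  -- Averaged over an optimal colouring, these sets contain each vertex of `C` with total weight `c`
  -- and each other vertex of `U` with at least `1`.
  have hind : ∀ I : IndepFamily G, setWeight w (C ∪ (I.1 ∩ U)) ≤ 1 := fun I => by
    refine hI _ ?_
    rintro x (hx | ⟨hx, hxU⟩) y (hy | ⟨hy, hyU⟩) hne hadj
    · exact hC x hx y (hCU hy) hadj
    · exact hC x hx y hyU hadj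
    · exact hC y hy x hxU hadj.symm
    · exact I.2 hx hy hne hadj
  calc setWeight w U + (fractionalChromaticNumber G - 1) * setWeight w C
      ≤ ∑ x, w x * ∑ I : IndepFamily G, f I * (C ∪ (I.1 ∩ U)).indicator 1 x := by
        simp only [setWeight]
        rw [Finset.mul_sum, ← Finset.sum_add_distrib]
        refine Finset.sum_le_sum fun x _ => ?_
        have : U.indicator 1 x + (fractionalChromaticNumber G - 1) * C.indicator 1 x ≤
            ∑ I : IndepFamily G, f I * (C ∪ (I.1 ∩ U)).indicator 1 x := by
          by_cases hx : x ∈ C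
          · simp [hx, hCU hx, hfs]
          · by_cases hxU : x ∈ U
            · simpa [hx, hxU, Set.indicator_apply] using hfc x
            · simp [hx, hxU]
        calc _ = w x * (U.indicator 1 x + (fractionalChromaticNumber G - 1) * C.indicator 1 x) := by
              ring
          _ ≤ _ := mul_le_mul_of_nonneg_left this (hw x)
    _ = ∑ I : IndepFamily G, f I * setWeight w (C ∪ (I.1 ∩ U)) := by
        simp only [setWeight, Finset.mul_sum]
        rw [Finset.sum_comm]
        exact Finset.sum_congr rfl fun _ _ => Finset.sum_congr rfl fun _ _ => by ring
    _ ≤ ∑ I, f I := Finset.sum_le_sum fun I _ => mul_le_of_le_one_right (hf0 I) (hind I)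
    _ = _ := hfs

/-- The weight of the layers of an independent set in a cone. -/
theorem layered_setWeight_le {V : Type*} [Fintype V] [Nonempty V] (G : SimpleGraph V) {w : V → ℝ}
    (hw : ∀ x, 0 ≤ w x) (hsum : ∑ x, w x = fractionalChromaticNumber G)
    (hI : ∀ I : Set V, G.IsIndepSet I → setWeight w I ≤ 1)
    (S : ℕ → Set V) (hS0 : G.IsIndepSet (S 0))
    (hS : ∀ i, ∀ x ∈ S i, ∀ y ∈ S (i + 1), ¬ G.Adj x y) (n : ℕ) :
    ∑ i ∈ Finset.range n, (fractionalChromaticNumber G - 1) ^ (n - 1 - i) * setWeight w (S i) ≤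
      ∑ i ∈ Finset.range n, (fractionalChromaticNumber G - 1) ^ i := by
  -- The multipliers require `c - 1 ≥ 1`, which an edge provides; without edges `c = 1` and every
  -- set has weight at most `1`.
  by_cases hG : ∃ x y, G.Adj x y
  · obtain ⟨x, y, hxy⟩ := hG
    have h2 := two_le_fractionalChromaticNumber hxy
    -- `μ i` weighs the part of `S i` shared with a neighbouring layer, which is isolated in `S i ∪
    -- S (i + 1)`. All of `S 0` qualifies for `i = 0`, because the base set is independent.
    refine weighted_sum_le_geom_sum (by linarith) n (fun i => setWeight w (S i))
      (fun i => setWeight w (S i ∩ S (i + 1)))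
      (fun i => Nat.casesOn i (setWeight w (S 0))
        fun i => setWeight w (S (i + 1) ∩ (S i ∪ S (i + 2)))) rfl (hI _ hS0) ?_ ?_ ?_
    · rintro (_ | i)
      · exact setWeight_mono hw Set.inter_subset_left
      · exact setWeight_mono hw (Set.inter_subset_inter_right _ Set.subset_union_right)
    · intro i
      refine setWeight_mono hw fun x hx => ⟨hx.2, Or.inl hx.1⟩
    · intro i
      rw [← setWeight_union, show 1 + (fractionalChromaticNumber G - 1) =
        fractionalChromaticNumber G by ring]
      rcases i with _ | i
      · refine setWeight_add_le G hw hI Set.subset_union_left ?_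
        rintro x hx y (hy | hy) hadj
        · exact hS0 hx hy hadj.ne hadj
        · exact hS 0 x hx y hy hadj
      · refine setWeight_add_le G hw hI (Set.inter_subset_left.trans Set.subset_union_left) ?_
        rintro x ⟨hx, hx' | hx'⟩ y (hy | hy) hadj
        · exact hS i x hx' y hy hadj
        · exact hS (i + 1) x hx y hy hadj
        · exact hS (i + 1) y hy x hx' hadj.symm
        · exact hS (i + 1) x hx y hy hadj
  · push Not at hG
    have h1 : fractionalChromaticNumber G = 1 := le_antisymm (fractionalChromaticNumber_le_one hG)
      (one_le_fractionalChromaticNumber G (Classical.arbitrary V))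
    have hle : ∀ A : Set V, setWeight w A ≤ 1 := fun A => by
      refine (setWeight_mono hw (Set.subset_univ A)).trans_eq ?_
      simp [setWeight, hsum, h1]
    rw [← Finset.sum_range_reflect (fun i => (fractionalChromaticNumber G - 1) ^ i) n]
    exact Finset.sum_le_sum fun i _ =>
      mul_le_of_le_one_right (pow_nonneg (by rw [h1, sub_self]) _) (hle _)

/-! ### The lower bound from a single cone. -/

/-- The vertex `(x, i)` of the cone `Δ_{h(v)}(G, v)`, with junk value `(x, 0)` if `h v ≤ i`. -/
noncomputable def HConeVertex.inCone {V W : Type*} (h : W → ℕ) (v : W) (i : ℕ) (x : V) :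
    HConeVertex V h :=
  open Classical in if hi : i ∈ Set.Ioo 0 (h v) then .layer v ⟨i, hi⟩ x else .base x

theorem hCone_adj_inCone_succ {V W : Type*} (G : SimpleGraph V) (H : SimpleGraph W) (h : W → ℕ)
    {v : W} {i : ℕ} (hi : i + 1 < h v) {x y : V} (hxy : G.Adj x y) :
    (hCone G H h).Adj (.inCone h v i x) (.inCone h v (i + 1) y) := by
  have h1 : i + 1 ∈ Set.Ioo 0 (h v) := ⟨i.succ_pos, hi⟩
  rcases Nat.eq_zero_or_pos i with rfl | h0
  · rw [HConeVertex.inCone, HConeVertex.inCone, dif_neg (by simp), dif_pos h1]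
    exact ⟨hxy, rfl⟩
  · rw [HConeVertex.inCone, HConeVertex.inCone, dif_pos ⟨h0, by lia⟩, dif_pos h1]
    exact ⟨rfl, hxy, Or.inl rfl⟩

theorem hCone_adj_inCone_apex {V W : Type*} (G : SimpleGraph V) (H : SimpleGraph W) (h : W → ℕ)
    {v : W} {i : ℕ} (hi : i + 1 = h v) (x : V) :
    (hCone G H h).Adj (.inCone h v i x) (.apex v) := by
  rcases Nat.eq_zero_or_pos i with rfl | h0
  · rw [HConeVertex.inCone, dif_neg (by simp)]
    exact hi.symm
  · rw [HConeVertex.inCone, dif_pos ⟨h0, by lia⟩]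
    exact ⟨rfl, hi⟩

theorem geom_sum_chi_pos {V : Type*} [Fintype V] {G : SimpleGraph V}
    (hG : 1 ≤ fractionalChromaticNumber G) {n : ℕ} (hn : 0 < n) :
    0 < ∑ k ∈ Finset.range n, (fractionalChromaticNumber G - 1) ^ k := by
  obtain ⟨k, rfl⟩ := Nat.exists_eq_succ_of_ne_zero hn.ne'
  rw [Finset.sum_range_succ', pow_zero]
  exact add_pos_of_nonneg_of_pos
    (Finset.sum_nonneg fun i _ => pow_nonneg (sub_nonneg.2 hG) _) one_pos

/-- Each of the cones from which `Δ_{H,h}(G)` is assembled bounds its fractional chromatic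
number from below. -/
theorem add_coneTau_le_hCone {V W : Type*} [Fintype V] [Fintype W] [Nonempty V]
    (G : SimpleGraph V) (H : SimpleGraph W) (h : W → ℕ) (v : W) (hv : 0 < h v) :
    fractionalChromaticNumber G + coneTau G (h v) ≤ fractionalChromaticNumber (hCone G H h) := by
  classical
  obtain ⟨w, hw, hsum, hI⟩ := exists_fractionalClique G
  have hc1 := one_le_fractionalChromaticNumber G (Classical.arbitrary V)
  have hσ := geom_sum_chi_pos hc1 hv
  have hchain := layered_setWeight_le G hw hsum hI
  have hτσ : coneTau G (h v) * ∑ k ∈ Finset.range (h v), (fractionalChromaticNumber G - 1) ^ k = 1 :=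
    one_div_mul_cancel hσ.ne'
  have hτ : 0 < coneTau G (h v) := one_div_pos.2 hσ
  set τ := coneTau G (h v)
  set n := h v with hn
  set c := fractionalChromaticNumber G with hc
  have hm : 0 ≤ c - 1 := by linarith
  let b : Option (Fin n × V) → ℝ :=
    fun o => o.elim τ fun p => τ * (c - 1) ^ (n - 1 - (p.1 : ℕ)) * w p.2
  have hb : ∀ o, 0 ≤ b o := by
    rintro (_ | p)
    · exact hτ.le
    · exact mul_nonneg (mul_nonneg hτ.le (pow_nonneg hm _)) (hw _)
  have htot : ∑ o, b o = c + τ := by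
    simp only [Fintype.sum_option, Fintype.sum_prod_type, b, Option.elim_none, Option.elim_some]
    simp only [← Finset.mul_sum, hsum, ← Finset.sum_mul]
    rw [Fin.sum_univ_eq_sum_range (fun i => (c - 1) ^ (n - 1 - i)) n,
      Finset.sum_range_reflect (fun i => (c - 1) ^ i) n, hτσ]
    ring
  rw [← htot]
  refine sum_le_fractionalChromaticNumber _ b hb
    (fun o => o.elim (.apex v) fun p => .inCone h v p.1 p.2) fun I hInd => ?_
  -- The condition `i < n` discards the default base values of `inCone` above the top layer.
  let S : ℕ → Set V := fun i => {x | i < n ∧ HConeVertex.inCone h v i x ∈ I}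
  have hS0 : G.IsIndepSet (S 0) := by
    rintro x ⟨_, hx⟩ y ⟨_, hy⟩ hne hadj
    rw [HConeVertex.inCone, dif_neg (by simp)] at hx hy
    exact hInd hx hy (fun e => hne (HConeVertex.base.inj e)) hadj
  have hS : ∀ i, ∀ x ∈ S i, ∀ y ∈ S (i + 1), ¬ G.Adj x y := by
    rintro i x ⟨_, hx⟩ y ⟨hi, hy⟩ hadj
    have := hCone_adj_inCone_succ G H h hi hadj
    exact hInd hx hy this.ne this
  have hsplit : ∑ o, b o * I.indicator 1 (o.elim (.apex v) fun p => .inCone h v p.1 p.2) =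
      τ * (I.indicator 1 (HConeVertex.apex v) +
        ∑ i ∈ Finset.range n, (c - 1) ^ (n - 1 - i) * setWeight w (S i)) := by
    simp only [Fintype.sum_option, Fintype.sum_prod_type, b, Option.elim_none, Option.elim_some]
    rw [mul_add, ← Fin.sum_univ_eq_sum_range (fun i => (c - 1) ^ (n - 1 - i) * setWeight w (S i)),
      Finset.mul_sum]
    congr 1
    refine Finset.sum_congr rfl fun i _ => ?_
    simp only [setWeight, Finset.mul_sum]
    refine Finset.sum_congr rfl fun x _ => ?_
    have : (S i).indicator (1 : V → ℝ) x =
        I.indicator 1 (HConeVertex.inCone h v (i : ℕ) x) := by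
      simp [S, Set.indicator_apply]
    rw [this]
    ring
  rw [hsplit]
  refine (mul_le_mul_of_nonneg_left ?_ hτ.le).trans_eq hτσ
  -- An apex in `I` empties the top layer; its unit replaces the constant term of the geometric sum,
  -- and the lower layers obey the chain bound times `c - 1`.
  by_cases hap : HConeVertex.apex v ∈ I
  · obtain ⟨k, hk⟩ := Nat.exists_eq_succ_of_ne_zero hv.ne'
    have hSk : S k = ∅ := by
      ext x
      simp only [Set.mem_empty_iff_false, iff_false]
      rintro ⟨_, hx⟩
      have := hCone_adj_inCone_apex G H h (v := v) hk.symm x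
      exact hInd hx hap this.ne this
    rw [hk, Finset.sum_range_succ, hSk, Finset.sum_range_succ']
    have e : ∑ i ∈ Finset.range k, (c - 1) ^ (k.succ - 1 - i) * setWeight w (S i) =
        (c - 1) * ∑ i ∈ Finset.range k, (c - 1) ^ (k - 1 - i) * setWeight w (S i) := by
      rw [Finset.mul_sum]
      refine Finset.sum_congr rfl fun i hi => ?_
      rw [show k.succ - 1 - i = (k - 1 - i) + 1 by
        have := Finset.mem_range.1 hi
        lia, pow_succ]
      ring
    have e' : ∑ i ∈ Finset.range k, (c - 1) ^ (i + 1) =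
        (c - 1) * ∑ i ∈ Finset.range k, (c - 1) ^ i := by
      rw [Finset.mul_sum]
      exact Finset.sum_congr rfl fun i _ => pow_succ' _ _
    have := mul_le_mul_of_nonneg_left (hchain S hS0 hS k) hm
    rw [e, e']
    simp only [hap, Set.indicator_of_mem, Pi.one_apply, setWeight_empty, mul_zero, pow_zero]
    linarith
  · simpa [hap] using hchain S hS0 hS n

/-! ### The upper bound for even height. -/

/-- The independent sets of `Δ_{H,n}(G)`, `n` even, out of which an optimal colouring is built.
The distance of the layer `i` of the cone of `v` from the apex is `n - i`, reduced by one if the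
apex is in the set; the layers at distance at most `2 * t` are full or empty according to the
parity of the distance, and the others are copies of `I`. -/
def coneIndepSet {V W : Type*} (n : ℕ) (I : Set V) (J : Set W) (t : ℕ) :
    Set (HConeVertex V (fun _ : W => n)) :=
  {z | match z with
    | .base x => x ∈ I
    | .layer v i x => (v ∈ J ∧ (2 * t < n - i - 1 ∧ x ∈ I ∨ n - i - 1 ≤ 2 * t ∧ Odd (n - i - 1))) ∨
        (v ∉ J ∧ (2 * t < n - i ∧ x ∈ I ∨ n - i ≤ 2 * t ∧ Odd (n - i : ℕ)))
    | .apex v => v ∈ J}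

/-- Full layers have odd distance, so the last layer before the copies of `I` begin, at distance `2
* t`, is empty. Likewise a chosen apex sees an empty layer, at reduced distance `0`. Near the base,
`ht` and the evenness of `n` keep layer `1` from being full when `I` is nonempty. -/
theorem isIndepSet_coneIndepSet {V W : Type*} {G : SimpleGraph V} {H : SimpleGraph W} {n : ℕ}
    (hn : Even n) {I : Set V} (hI : G.IsIndepSet I) {J : Set W} (hJ : H.IsIndepSet J)
    {t : ℕ} (ht : I = ∅ ∨ 2 * t < n) :
    (constHCone G H n).IsIndepSet (coneIndepSet n I J t) := by
  obtain ⟨l, hl⟩ := hn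
  have hII : ∀ x ∈ I, ∀ y ∈ I, ¬ G.Adj x y := fun x hx y hy hxy => hI hx hy hxy.ne hxy
  have hbl : ∀ x v i y, HConeVertex.base x ∈ coneIndepSet n I J t →
      HConeVertex.layer v i y ∈ coneIndepSet n I J t → G.Adj x y → (i : ℕ) = 1 → False := by
    intro x v i y hx hy hxy hi
    have hx : x ∈ I := hx
    have ht : 2 * t < n := ht.resolve_left (Set.nonempty_iff_ne_empty.1 ⟨x, hx⟩)
    have hi2 := i.2.2
    rcases hy with ⟨_, ⟨_, hy⟩ | ⟨h1, h2⟩⟩ | ⟨_, ⟨_, hy⟩ | ⟨h1, h2⟩⟩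
    · exact hII x hx y hy hxy
    · rw [Nat.odd_iff] at h2; lia
    · exact hII x hx y hy hxy
    · rw [Nat.odd_iff] at h2; lia
  have hll : ∀ v (i j : Set.Ioo 0 n) x y,
      HConeVertex.layer v i x ∈ coneIndepSet n I J t →
      HConeVertex.layer v j y ∈ coneIndepSet n I J t → G.Adj x y → (i : ℕ) + 1 = j → False := by
    intro v i j x y hx hy hxy hij
    have hi2 := i.2.2
    have hj2 := j.2.2
    rcases hx with ⟨hv, ⟨h1, hx⟩ | ⟨h1, h2⟩⟩ | ⟨hv, ⟨h1, hx⟩ | ⟨h1, h2⟩⟩ <;>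
      rcases hy with ⟨hv', ⟨h3, hy⟩ | ⟨h3, h4⟩⟩ | ⟨hv', ⟨h3, hy⟩ | ⟨h3, h4⟩⟩ <;>
      first
        | exact hv hv'
        | exact hv' hv
        | exact hII x hx y hy hxy
        | (simp only [Nat.odd_iff] at *; lia)
  have hla : ∀ v (i : Set.Ioo 0 n) x, HConeVertex.layer v i x ∈ coneIndepSet n I J t →
      HConeVertex.apex v ∈ coneIndepSet n I J t → (i : ℕ) + 1 = n → False := by
    intro v i x hx hv hi
    have hv : v ∈ J := hv
    rcases hx with ⟨_, ⟨h1, _⟩ | ⟨h1, h2⟩⟩ | ⟨hv', _⟩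
    · lia
    · rw [Nat.odd_iff] at h2; lia
    · exact hv' hv
  rintro (x | ⟨v, i, x⟩ | v) hx (y | ⟨u, j, y⟩ | u) hy - hadj
  · exact hII x hx y hy hadj
  · exact hbl x u j y hx hy hadj.1 hadj.2
  · have : n = 1 := hadj
    lia
  · exact hbl y v i x hy hx hadj.1.symm hadj.2
  · obtain ⟨rfl, hxy, hij | hij⟩ := hadj
    · exact hll v i j x y hx hy hxy hij
    · exact hll v j i y x hy hx hxy.symm hij
  · obtain ⟨rfl, hi⟩ := hadj
    exact hla v i x hx hy hi
  · have : n = 1 := hadj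
    lia
  · obtain ⟨rfl, hi⟩ := hadj
    exact hla _ j y hy hx hi
  · exact hJ hx hy (SimpleGraph.Adj.ne (G := H) hadj) hadj

theorem geom_sum_two_mul {R : Type*} [CommRing R] (m : R) (l : ℕ) :
    ∑ k ∈ Finset.range (l + l), m ^ k = (1 + m) * ∑ k ∈ Finset.range l, (m ^ 2) ^ k := by
  induction l with
  | zero => simp
  | succ l ih =>
    rw [show l + 1 + (l + 1) = l + l + 1 + 1 by ring, Finset.sum_range_succ, Finset.sum_range_succ,
      ih, Finset.sum_range_succ _ l]
    ring

/-- Tail probabilities solving the recurrence `q r = m ^ 2 * q (r + 1) + (1 + m) * τ`. -/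
theorem exists_tail_probabilities {m τ : ℝ} (hm : 0 ≤ m) (hτ : 0 ≤ τ) {l : ℕ}
    (hτs : τ * ∑ k ∈ Finset.range (l + l), m ^ k = 1) :
    ∃ q : ℕ → ℝ, q 0 = 1 ∧ q l = 0 ∧ Antitone q ∧
      ∀ r < l, q r = m ^ 2 * q (r + 1) + (1 + m) * τ := by
  -- The recurrence solved backwards from `q l = 0`; `q 0 = 1` because the geometric sum has an even
  -- number of terms.
  refine ⟨fun r => (1 + m) * τ * ∑ k ∈ Finset.range (l - r), (m ^ 2) ^ k, ?_, by simp, ?_, ?_⟩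
  · rw [geom_sum_two_mul] at hτs
    simp only [Nat.sub_zero]
    linarith
  · intro r s hrs
    refine mul_le_mul_of_nonneg_left ?_ (by positivity)
    exact Finset.sum_le_sum_of_subset_of_nonneg
      (Finset.range_subset_range.2 (Nat.sub_le_sub_left hrs l)) fun _ _ _ => by positivity
  · intro r hr
    simp only
    rw [show l - r = l - (r + 1) + 1 by lia, geom_sum_succ]
    ring

/-- The three choices are independent, so the sum factors; `b` selects between two expressions
affine in `χ`. -/
theorem sum_triple_mixture {α κ β : Type*} [Fintype α] [Fintype κ] [Fintype β]
    (f χ : α → ℝ) (g b : κ → ℝ) (p a₁ b₁ a₀ b₀ : β → ℝ) (c : ℝ) :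
    ∑ z : α × κ × β, f z.1 * g z.2.1 * p z.2.2 / c *
        (b z.2.1 * (a₁ z.2.2 * χ z.1 + b₁ z.2.2) +
          (1 - b z.2.1) * (a₀ z.2.2 * χ z.1 + b₀ z.2.2)) =
      ((∑ k, g k * b k) * ((∑ t, p t * a₁ t) * ∑ i, f i * χ i + (∑ t, p t * b₁ t) * ∑ i, f i) +
        (∑ k, g k - ∑ k, g k * b k) *
          ((∑ t, p t * a₀ t) * ∑ i, f i * χ i + (∑ t, p t * b₀ t) * ∑ i, f i)) / c := by
  set A₁ := ∑ t, p t * a₁ t with hA₁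
  set B₁ := ∑ t, p t * b₁ t with hB₁
  set A₀ := ∑ t, p t * a₀ t with hA₀
  set B₀ := ∑ t, p t * b₀ t with hB₀
  have h1 : ∀ i k, ∑ t, f i * g k * p t / c *
      (b k * (a₁ t * χ i + b₁ t) + (1 - b k) * (a₀ t * χ i + b₀ t)) =
      g k * b k * (f i * (A₁ * χ i + B₁ - A₀ * χ i - B₀) / c) +
        g k * (f i * (A₀ * χ i + B₀) / c) := fun i k => by
    trans A₁ * (f i * g k * b k * χ i / c) + B₁ * (f i * g k * b k / c) +
      A₀ * (f i * g k * (1 - b k) * χ i / c) + B₀ * (f i * g k * (1 - b k) / c)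
    · rw [hA₁, hB₁, hA₀, hB₀, Finset.sum_mul, Finset.sum_mul, Finset.sum_mul, Finset.sum_mul,
        ← Finset.sum_add_distrib, ← Finset.sum_add_distrib, ← Finset.sum_add_distrib]
      exact Finset.sum_congr rfl fun t _ => by ring
    · ring
  simp only [Fintype.sum_prod_type, h1, Finset.sum_add_distrib, ← Finset.sum_mul]
  simp only [← Finset.sum_div, ← Finset.mul_sum]
  have h2 : ∑ i, f i * (A₁ * χ i + B₁ - A₀ * χ i - B₀) =
      (A₁ - A₀) * ∑ i, f i * χ i + (B₁ - B₀) * ∑ i, f i := by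
    rw [Finset.mul_sum, Finset.mul_sum, ← Finset.sum_add_distrib]
    exact Finset.sum_congr rfl fun i _ => by ring
  have h3 : ∑ i, f i * (A₀ * χ i + B₀) = A₀ * ∑ i, f i * χ i + B₀ * ∑ i, f i := by
    rw [Finset.mul_sum, Finset.mul_sum, ← Finset.sum_add_distrib]
    exact Finset.sum_congr rfl fun i _ => by ring
  rw [h2, h3]
  ring

theorem sum_fin_tail (q : ℕ → ℝ) {l r : ℕ} (hr : r ≤ l) :
    ∑ t : Fin l, (q t - q (t + 1)) * (if (t : ℕ) < r then 1 else 0) = q 0 - q r := by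
  rw [Fin.sum_univ_eq_sum_range (fun t => (q t - q (t + 1)) * (if t < r then (1 : ℝ) else 0)) l,
    ← Finset.sum_range_sub' q r]
  simp only [mul_ite, mul_one, mul_zero]
  rw [← Finset.sum_filter]
  refine Finset.sum_congr ?_ fun _ _ => rfl
  ext t
  simp only [Finset.mem_filter, Finset.mem_range]
  lia

theorem indicator_coneIndepSet_base {V W : Type*} (n : ℕ) (I : Set V) (J : Set W) (t : ℕ) (x : V) :
    (coneIndepSet n I J t).indicator (1 : HConeVertex V (fun _ : W => n) → ℝ) (.base x) =
      I.indicator 1 x := by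
  classical
  simp [coneIndepSet, Set.indicator_apply]

theorem indicator_coneIndepSet_apex {V W : Type*} (n : ℕ) (I : Set V) (J : Set W) (t : ℕ) (v : W) :
    (coneIndepSet n I J t).indicator (1 : HConeVertex V (fun _ : W => n) → ℝ) (.apex v) =
      J.indicator 1 v := by
  classical
  simp [coneIndepSet, Set.indicator_apply]

open Classical in
theorem indicator_coneIndepSet_layer {V W : Type*} (n : ℕ) (I : Set V) (J : Set W) (t : ℕ)
    (v : W) (i : Set.Ioo 0 n) (x : V) :
    (coneIndepSet n I J t).indicator (1 : HConeVertex V (fun _ : W => n) → ℝ) (.layer v i x) =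
      J.indicator 1 v * ((if 2 * t < n - i - 1 then 1 else 0) * I.indicator 1 x +
          (if n - i - 1 ≤ 2 * t ∧ Odd (n - i - 1) then 1 else 0)) +
        (1 - J.indicator 1 v) * ((if 2 * t < n - i then 1 else 0) * I.indicator 1 x +
          (if n - i ≤ 2 * t ∧ Odd (n - i : ℕ) then 1 else 0)) := by
  by_cases hv : v ∈ J
  · by_cases h : 2 * t < n - i - 1
    · have h' : ¬ n ≤ 2 * t + 1 + i := by lia
      simp [coneIndepSet, Set.indicator_apply, hv, h, h']
    · have h' : n ≤ 2 * t + 1 + i := by lia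
      simp [coneIndepSet, Set.indicator_apply, hv, h, h']
  · by_cases h : 2 * t < n - i
    · have h' : ¬ n ≤ 2 * t + i := by lia
      simp [coneIndepSet, Set.indicator_apply, hv, h, h']
    · have h' : n ≤ 2 * t + i := by lia
      simp [coneIndepSet, Set.indicator_apply, hv, h, h']

/-- The fractional chromatic number of a cone of constant even height is at most that of the
cone over a single vertex. -/
theorem constHCone_le_add_coneTau {V W : Type*} [Fintype V] [Fintype W]
    (G : SimpleGraph V) (H : SimpleGraph W)
    (hHG : fractionalChromaticNumber H ≤ fractionalChromaticNumber G)
    (hG : 1 ≤ fractionalChromaticNumber G) {n : ℕ} (hn0 : 0 < n) (hn : Even n) :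
    fractionalChromaticNumber (constHCone G H n) ≤
      fractionalChromaticNumber G + coneTau G n := by
  classical
  obtain ⟨l, rfl⟩ := hn
  obtain ⟨f, hf0, hfs, hfc⟩ := exists_optimal_cover G
  obtain ⟨κ, _, g, J, hg0, hJ, hgs, hgc⟩ := exists_exact_cover H hHG
  have hσ := geom_sum_chi_pos hG hn0
  have hτσ : coneTau G (l + l) *
      ∑ k ∈ Finset.range (l + l), (fractionalChromaticNumber G - 1) ^ k = 1 :=
    one_div_mul_cancel hσ.ne'
  have hτ : 0 < coneTau G (l + l) := one_div_pos.2 hσ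
  set τ := coneTau G (l + l)
  set c := fractionalChromaticNumber G with hc
  have hc0 : 0 < c := by linarith
  obtain ⟨q, hq0, hql, hqa, hqr⟩ := exists_tail_probabilities (sub_nonneg.2 hG) hτ.le hτσ
  let p : Fin l → ℝ := fun t => q t - q (t + 1)
  have hp0 : ∀ t, 0 ≤ p t := fun t => sub_nonneg.2 (hqa (Nat.le_succ _))
  have hps : ∑ t, p t = 1 := by
    have := sum_fin_tail q le_rfl (l := l)
    simpa [hq0, hql, p] using this
  let ω : IndepFamily G × κ × Fin l → ℝ := fun z => f z.1 * g z.2.1 * p z.2.2 / c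
  have hω0 : ∀ z, 0 ≤ ω z := fun z =>
    div_nonneg (mul_nonneg (mul_nonneg (hf0 _) (hg0 _)) (hp0 _)) hc0.le
  have hcov : ∀ (χ : IndepFamily G → ℝ) (b : κ → ℝ) (a₁ b₁ a₀ b₀ : Fin l → ℝ),
      ∑ z, ω z * (b z.2.1 * (a₁ z.2.2 * χ z.1 + b₁ z.2.2) +
          (1 - b z.2.1) * (a₀ z.2.2 * χ z.1 + b₀ z.2.2)) =
      ((∑ k, g k * b k) * ((∑ t, p t * a₁ t) * ∑ i, f i * χ i + (∑ t, p t * b₁ t) * c) +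
        (c - ∑ k, g k * b k) *
          ((∑ t, p t * a₀ t) * ∑ i, f i * χ i + (∑ t, p t * b₀ t) * c)) / c := by
    intro χ b a₁ b₁ a₀ b₀
    have := sum_triple_mixture f χ g b p a₁ b₁ a₀ b₀ c
    rwa [hfs, hgs] at this
  have hωs : ∑ z, ω z = c := by
    have := hcov (fun _ => 0) (fun _ => 1) (fun _ => 0) (fun _ => 1) (fun _ => 0) (fun _ => 0)
    simp [hgs, hps] at this
    exact this
  have key := fractionalChromaticNumber_le_of_cover (constHCone G H (l + l))
    (ι := Option (IndepFamily G × κ × Fin l)) (fun o => o.elim τ ω)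
    (by rintro (_ | z); exacts [hτ.le, hω0 z])
    -- The extra set has no base vertex and no apex: it consists of all layers at odd distance from
    -- the apex.
    (fun o => o.elim (coneIndepSet (l + l) ∅ ∅ l)
      fun z => coneIndepSet (l + l) (z.1.1 : Set V) (J z.2.1) z.2.2)
    (by
      rintro (_ | z)
      · exact isIndepSet_coneIndepSet ⟨l, rfl⟩ (by simp [SimpleGraph.IsIndepSet])
          (by simp [SimpleGraph.IsIndepSet]) (Or.inl rfl)
      · refine isIndepSet_coneIndepSet ⟨l, rfl⟩ z.1.2 (hJ _) (Or.inr ?_)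
        have := z.2.2.2
        lia) ?_
  · rw [Fintype.sum_option] at key
    simp only [Option.elim_none, Option.elim_some, hωs] at key
    linarith
  intro y
  rw [Fintype.sum_option]
  simp only [Option.elim_none, Option.elim_some]
  rcases y with x | ⟨v, i, x⟩ | v
  · have := hcov (fun I => (I.1 : Set V).indicator 1 x) (fun _ => 1) (fun _ => 1) (fun _ => 0)
      (fun _ => 0) (fun _ => 0)
    simp only [mul_one, hgs, hps, one_mul, mul_zero, Finset.sum_const_zero, zero_mul, add_zero,
      sub_self, mul_div_cancel_left₀ _ hc0.ne'] at this
    simp only [indicator_coneIndepSet_base, Set.indicator_empty, mul_zero, zero_add]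
    exact (hfc x).trans_eq this.symm
  · have hsum := hcov (fun I => (I.1 : Set V).indicator 1 x) (fun k => (J k).indicator 1 v)
      (fun t => if 2 * (t : ℕ) < l + l - i - 1 then 1 else 0)
      (fun t => if l + l - i - 1 ≤ 2 * (t : ℕ) ∧ Odd (l + l - i - 1) then 1 else 0)
      (fun t => if 2 * (t : ℕ) < l + l - i then 1 else 0)
      (fun t => if l + l - i ≤ 2 * (t : ℕ) ∧ Odd (l + l - i : ℕ) then 1 else 0)
    simp only [indicator_coneIndepSet_layer] at hsum ⊢
    rw [hsum, hgc v]
    have hx := hfc x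
    set X := ∑ I : IndepFamily G, f I * (I.1 : Set V).indicator 1 x
    have hi0 := i.2.1
    have hi1 := i.2.2
    have hA : ∀ r ≤ l, ∀ j, j = 2 * r ∨ j + 1 = 2 * r →
        ∑ t : Fin l, p t * (if 2 * (t : ℕ) < j then 1 else 0) = 1 - q r := by
      intro r hr j hj
      rw [show 1 - q r = q 0 - q r by rw [hq0], ← sum_fin_tail q hr]
      refine Finset.sum_congr rfl fun t _ => ?_
      rw [if_congr (show 2 * (t : ℕ) < j ↔ (t : ℕ) < r by lia) rfl rfl]
    have hBodd : ∀ r ≤ l, ∀ j, j + 1 = 2 * r →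
        ∑ t : Fin l, p t * (if j ≤ 2 * (t : ℕ) ∧ Odd j then 1 else 0) = q r := by
      intro r hr j hj
      have h1 := hA r hr j (Or.inr hj)
      have hodd : Odd j := Nat.odd_iff.2 (by lia)
      have h2 : ∑ t : Fin l, p t * (if j ≤ 2 * (t : ℕ) ∧ Odd j then 1 else 0) =
          ∑ t, p t - ∑ t : Fin l, p t * (if 2 * (t : ℕ) < j then 1 else 0) := by
        rw [← Finset.sum_sub_distrib]
        refine Finset.sum_congr rfl fun t _ => ?_
        by_cases h : 2 * (t : ℕ) < j
        · simp [h, h.not_ge]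
        · simp [h, not_lt.1 h, hodd]
      rw [h2, h1, hps]
      ring
    have hBeven : ∀ j, Even j →
        ∑ t : Fin l, p t * (if j ≤ 2 * (t : ℕ) ∧ Odd j then 1 else 0) = 0 := by
      intro j hj
      simp [Nat.not_odd_iff_even.2 hj]
    have hq1 : ∀ r, 0 ≤ 1 - q r := fun r => by
      have := hqa (Nat.zero_le r)
      linarith
    -- At even distance `2 * r` the coverage is `(1 - q r) * X + q r ≥ 1` without the extra set. At
    -- odd distance `2 * r + 1` the extra `τ` is needed, and the recurrence for `q` gives exactly
    -- `1` when `X = 1`.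
    rcases Nat.even_or_odd (l + l - i : ℕ) with hj | hj
    · obtain ⟨r, hr⟩ := hj
      have hrl : r ≤ l := by lia
      rw [hA r hrl (l + l - i - 1) (by lia), hBodd r hrl (l + l - i - 1) (by lia),
        hA r hrl (l + l - i) (by lia), hBeven (l + l - i) ⟨r, hr⟩]
      simp only [Set.indicator_of_notMem (Set.notMem_empty _),
        Nat.not_odd_iff_even.2 (⟨r, hr⟩ : Even (l + l - i : ℕ)), and_false, if_false, mul_zero,
        zero_mul, add_zero, zero_add, one_mul]
      rw [le_div_iff₀ hc0]
      have h1 := mul_le_mul_of_nonneg_left hx (hq1 r)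
      have h2 := mul_le_mul_of_nonneg_left h1 hc0.le
      linarith
    · have hj' := hj
      obtain ⟨r, hr⟩ := hj
      have hrl : r < l := by lia
      rw [hA r hrl.le (l + l - i - 1) (by lia), hBeven (l + l - i - 1) (by
          rw [Nat.even_iff]; lia),
        hA (r + 1) hrl (l + l - i) (by lia), hBodd (r + 1) hrl (l + l - i) (by lia)]
      have hle : l + l - (i : ℕ) ≤ 2 * l := by lia
      simp only [Set.indicator_of_notMem (Set.notMem_empty _), hj', hle, and_true, if_true]
      have h1 := mul_le_mul_of_nonneg_left hx (hq1 r)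
      have h2 := mul_le_mul_of_nonneg_left
        (mul_le_mul_of_nonneg_left hx (hq1 (r + 1))) (sub_nonneg.2 hG)
      have h3 := hqr r hrl
      have e : τ * (0 * (0 + 0) + (1 - 0) * (0 + 1)) = τ := by ring
      have : 1 - τ ≤ (1 * ((1 - q r) * X + 0 * c) +
          (c - 1) * ((1 - q (r + 1)) * X + q (r + 1) * c)) / c := by
        rw [le_div_iff₀ hc0]
        linarith
      simp only [mul_zero]
      linarith
  · have := hcov (fun _ => 0) (fun k => (J k).indicator 1 v) (fun _ => 0) (fun _ => 1)
      (fun _ => 0) (fun _ => 0)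
    simp only [hgc, hps, mul_zero, mul_one, zero_mul, add_zero, Finset.sum_const_zero, zero_add,
      one_mul, div_self hc0.ne'] at this
    simp only [indicator_coneIndepSet_apex, Set.indicator_empty, mul_zero, zero_add]
    exact this.ge

/-! ### Homomorphisms between cones of different heights. -/

/-- Collapsing the lowest layers of each cone to the base decreases the heights to their
minimum. -/
theorem hCone_le_constHCone {V W : Type*} [Fintype V] [Fintype W]
    (G : SimpleGraph V) (H : SimpleGraph W) (h : W → ℕ) {n : ℕ} (hn0 : 0 < n)
    (hn : ∀ v, n ≤ h v) :
    fractionalChromaticNumber (hCone G H h) ≤ fractionalChromaticNumber (constHCone G H n) := by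
  let φ : HConeVertex V h → HConeVertex V (fun _ : W => n)
    | .base x => .base x
    -- Truncated subtraction sends the layers `i ≤ h v - n` to the base, where edges of `G` are
    -- available.
    | .layer v i x => .inCone (fun _ => n) v (i - (h v - n)) x
    | .apex v => .apex v
  have hbase : ∀ (v : W) (x : V), HConeVertex.inCone (fun _ : W => n) v 0 x = .base x := fun v x => by
    rw [HConeVertex.inCone, dif_neg (by simp)]
  have hll : ∀ v (i j : Set.Ioo 0 (h v)) x y, G.Adj x y → (i : ℕ) + 1 = j →
      (constHCone G H n).Adj (φ (.layer v i x)) (φ (.layer v j y)) := by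
    intro v i j x y hxy hij
    have hj := j.2.2
    have hv := hn v
    simp only [φ]
    rcases le_or_gt (j : ℕ) (h v - n) with hle | hlt
    · rw [show (i : ℕ) - (h v - n) = 0 by lia, show (j : ℕ) - (h v - n) = 0 by lia, hbase, hbase]
      exact hxy
    · rw [show (j : ℕ) - (h v - n) = i - (h v - n) + 1 by lia]
      exact hCone_adj_inCone_succ G H _ (by lia) hxy
  have hbl : ∀ v (i : Set.Ioo 0 (h v)) x y, G.Adj x y → (i : ℕ) = 1 →
      (constHCone G H n).Adj (φ (.base x)) (φ (.layer v i y)) := by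
    intro v i x y hxy hi
    have hi1 := i.2.2
    have hv := hn v
    simp only [φ]
    rw [← hbase v x]
    rcases hv.eq_or_lt with heq | hlt
    · rw [show (i : ℕ) - (h v - n) = 0 + 1 by lia]
      exact hCone_adj_inCone_succ G H _ (by lia) hxy
    · rw [show (i : ℕ) - (h v - n) = 0 by lia, hbase, hbase]
      exact hxy
  have hla : ∀ v (i : Set.Ioo 0 (h v)) x, (i : ℕ) + 1 = h v →
      (constHCone G H n).Adj (φ (.layer v i x)) (φ (.apex v)) := by
    intro v i x hi
    have hv := hn v
    exact hCone_adj_inCone_apex G H _ (by lia) x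
  have hba : ∀ v x, h v = 1 → (constHCone G H n).Adj (φ (.base x)) (φ (.apex v)) := by
    intro v x hv
    have := hn v
    exact (by lia : n = 1)
  refine fractionalChromaticNumber_le_of_hom ⟨φ, ?_⟩
  rintro (x | ⟨v, i, x⟩ | v) (y | ⟨u, j, y⟩ | u) hadj
  · exact hadj
  · exact hbl u j x y hadj.1 hadj.2
  · exact hba u x hadj
  · exact (hbl v i y x hadj.1.symm hadj.2).symm
  · obtain ⟨rfl, hxy, hij | hij⟩ := hadj
    · exact hll v i j x y hxy hij
    · exact (hll v j i y x hxy.symm hij).symm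
  · obtain ⟨rfl, hi⟩ := hadj
    exact hla v i x hi
  · exact (hba v y hadj).symm
  · obtain ⟨rfl, hi⟩ := hadj
    exact (hla _ j y hi).symm
  · exact hadj

/-- The subgraph formed by the cones of height exactly `n`. -/
theorem constHCone_induce_le_hCone {V W : Type*} [Fintype V] [Fintype W]
    (G : SimpleGraph V) (H : SimpleGraph W) (h : W → ℕ) (n : ℕ)
    [Fintype {v : W | h v = n}] :
    fractionalChromaticNumber (constHCone G (H.induce {v : W | h v = n}) n) ≤
      fractionalChromaticNumber (hCone G H h) := by
  let φ : HConeVertex V (fun _ : {v : W | h v = n} => n) → HConeVertex V h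
    | .base x => .base x
    | .layer v i x => .layer v.1 ⟨i, i.2.1, i.2.2.trans_eq v.2.symm⟩ x
    | .apex v => .apex v.1
  refine fractionalChromaticNumber_le_of_hom ⟨φ, ?_⟩
  rintro (x | ⟨v, i, x⟩ | v) (y | ⟨u, j, y⟩ | u) hadj
  · exact hadj
  · exact hadj
  · exact u.2.trans hadj
  · exact hadj
  · obtain ⟨rfl, hxy, hij⟩ := hadj
    exact ⟨rfl, hxy, hij⟩
  · obtain ⟨rfl, hi⟩ := hadj
    exact ⟨rfl, Eq.trans hi v.2.symm⟩
  · exact v.2.trans hadj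
  · obtain ⟨rfl, hi⟩ := hadj
    exact ⟨rfl, Eq.trans hi u.2.symm⟩
  · exact hadj

/-! ### Assembly of the bounds. -/

theorem corollary8 {V W : Type*} [Fintype V] [Fintype W]
    (G : SimpleGraph V) (H : SimpleGraph W)
    (hHG : fractionalChromaticNumber H ≤ fractionalChromaticNumber G)
    (h : W → ℕ) (hpos : ∀ v, 0 < h v)
    (n : ℕ) (hn : IsLeast (Set.range h) n) :
    (fractionalChromaticNumber (constHCone G (H.induce {v : W | h v = n}) n) ≤
        fractionalChromaticNumber (hCone G H h) ∧
      fractionalChromaticNumber (hCone G H h) ≤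
        fractionalChromaticNumber (constHCone G H n)) ∧
    (Even n →
      fractionalChromaticNumber (hCone G H h) =
        fractionalChromaticNumber G + coneTau G n) := by
  obtain ⟨⟨v, hv⟩, hmin⟩ := hn
  have hn0 : 0 < n := hv ▸ hpos v
  have hle := hCone_le_constHCone G H h hn0 fun u => hmin ⟨u, rfl⟩
  refine ⟨⟨constHCone_induce_le_hCone G H h n, hle⟩, fun heven => le_antisymm ?_ ?_⟩
  · exact hle.trans (constHCone_le_add_coneTau G H hHG
      ((one_le_fractionalChromaticNumber H v).trans hHG) hn0 heven)
  · have hG : 1 ≤ fractionalChromaticNumber G := (one_le_fractionalChromaticNumber H v).trans hHG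
    -- For empty `V` the empty family is a cover of weight `0`, against `1 ≤ χ_f(H) ≤ χ_f(G)`.
    have : Nonempty V := by
      by_contra hV
      rw [not_nonempty_iff] at hV
      have := fractionalChromaticNumber_le_of_cover G (fun i : Empty => i.elim) (fun i => i.elim)
        (fun i => i.elim) (fun i => i.elim) (fun x => hV.elim x)
      simp only [Finset.univ_eq_empty, Finset.sum_empty] at this
      linarith
    subst hv
    exact add_coneTau_le_hCone G H h v hn0
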